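/- Let $H^1$ be the space of real-valued $u\in L^2(\mathbb{R})$ with weak derivative $u'\in L^2(\mathbb{R})$. For measurable $f\ge 0$ on $\mathbb{R}$ put \[ C[f]=\frac12\iint_{\mathbb{R}\times\mathbb{R}}\bigl(|x|+|y|-|x-y|\bigr)\,f(x)f(y)\,dx\,dy\in[0,\infty], \] where the kernel is nonnegative by the triangle inequality. Let $\mathcal{B}=\{u\in H^1: C[u^2]<\infty\}$ (the quartic space) and $\mathcal{B}_1=\{u\in\mathcal{B}:\|u\|_2=1\}$, and let \[ E[u]=\|u'\|_2^2+C[u^2]\qquad(u\in\mathcal{B}). \] (This is the Maxwell--Schrödinger energy in one space dimension in the neutral case $z=1$, with fixed point charge $\rho=-\delta_0$: when $\|u\|_2=1$ and $\int|x|u(x)^2\,dx<\infty$ one has $C[u^2]=-\frac12\iint|x-y|u(x)^2u(y)^2\,dx\,dy+\int|x|u(x)^2\,dx$.) Theorem. $E$ is bounded below on $\mathcal{B}_1$, and its infimum is attained: with $e_0=\inf_{v\in\mathcal{B}_1}E[v]$, there is $u\in\mathcal{B}_1$ such that $E[u]=e_0$. -/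

import Mathlib

open MeasureTheory

noncomputable section

namespace MaxwellSchrodinger

/-- `v` is a weak derivative of `u` on the real line: both are locally integrable and
`∫ u φ' = - ∫ v φ` for all smooth compactly supported test functions `φ`. -/
def IsWeakDeriv (u v : ℝ → ℝ) : Prop :=
  LocallyIntegrable u volume ∧ LocallyIntegrable v volume ∧
    ∀ φ : ℝ → ℝ, ContDiff ℝ (⊤ : ℕ∞) φ → HasCompactSupport φ →
      ∫ x, u x * deriv φ x = - ∫ x, v x * φ x

/-- The Sobolev space `H¹` of real-valued functions on the line: `u` is square integrable and
has a square integrable weak derivative. -/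
def MemH1 (u : ℝ → ℝ) : Prop :=
  MemLp u 2 volume ∧ ∃ v : ℝ → ℝ, MemLp v 2 volume ∧ IsWeakDeriv u v

open Classical in
/-- A representative of the weak derivative `u'` (unique almost everywhere) of a function `u`
that has one; the value `0` is used otherwise. -/
def weakDeriv (u : ℝ → ℝ) : ℝ → ℝ :=
  if h : ∃ v : ℝ → ℝ, IsWeakDeriv u v then h.choose else 0

/-- The bilinear form `b[f, g] = ∬ f(x) g(y) G(x, y) dx dy` with kernel `G`. -/
def bForm (G : ℝ → ℝ → ℝ) (f g : ℝ → ℝ) : ℝ :=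
  ∫ p : ℝ × ℝ, f p.1 * g p.2 * G p.1 p.2

/-- The quadratic functional `B[f] = b[f, f]`. -/
def bQuad (G : ℝ → ℝ → ℝ) (f : ℝ → ℝ) : ℝ :=
  bForm G f f

/-- The quartic space `𝓑 = {u ∈ H¹ : B[u²] < ∞}`. The condition `B[u²] < ∞` is expressed as
integrability of the integrand, which for a nonnegative kernel `G` is the same thing. -/
def quarticSpace (G : ℝ → ℝ → ℝ) : Set (ℝ → ℝ) :=
  {u | MemH1 u ∧
    Integrable (fun p : ℝ × ℝ => u p.1 ^ 2 * u p.2 ^ 2 * G p.1 p.2) volume}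

/-- The `L²`-normalised elements of a set of functions: `A₁ = {u ∈ A : ‖u‖₂ = 1}`. -/
def unitSphere (A : Set (ℝ → ℝ)) : Set (ℝ → ℝ) :=
  {u | u ∈ A ∧ eLpNorm u 2 volume = 1}

/-- The interaction kernel `(z (|x| + |y|) - |x - y|) / 2` for the point charge `-z δ₀`. -/
def coulombKernel (z x y : ℝ) : ℝ :=
  (z * (|x| + |y|) - |x - y|) / 2

/-- The energy `E[u] = ‖u'‖₂² + C[u²]`, where
`C[u²] = ½ ∬ (z (|x| + |y|) - |x - y|) u(x)² u(y)² dx dy`. -/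
def energy (z : ℝ) (u : ℝ → ℝ) : ℝ :=
  (∫ x, weakDeriv u x ^ 2) + bQuad (coulombKernel z) (fun x => u x ^ 2)

/-- The quartic space `𝓑` of the neutral case `z = 1`, in which `B = C`. -/
def neutralSpace : Set (ℝ → ℝ) :=
  quarticSpace (coulombKernel 1)

end MaxwellSchrodinger

end

/-!
The energy is nonnegative, and the direct method gives a minimizer because the neutral Coulomb
term is confining. The kernel `(|x| + |y| - |x - y|) / 2` equals `min |x| |y|` when `x` and `y` have
the same sign and vanishes otherwise. Hence a mass `m` located in `(R, ∞)`, or in `(-∞, -R)`, costs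
Coulomb energy at least `R m²`, and sequences of bounded energy are tight
(`integral_sub_setIntegral_Icc_le`).

Every function with a weak derivative `v` is almost everywhere a primitive `c + ∫₀ˣ v`
(`IsWeakDeriv.exists_ae_eq_primitive`), so a minimizing sequence may be taken to consist of
primitives with data `(cₙ, vₙ)`. The numbers `cₙ` are bounded (`IsAdmissible.sq_le`), the `vₙ` are
bounded in `L²`, and along a subsequence `cₙ → c` and `vₙ ⇀ w` weakly
(`exists_subseq_tendsto_integral_mul`). Testing weak convergence against indicators of intervals
shows that the primitives converge pointwise, with local uniform bounds. By tightness the limit still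
has mass one. The kinetic term is weakly lower semicontinuous and the Coulomb term is lower
semicontinuous by Fatou's lemma (`isAdmissible_of_tendsto`), so the limit is a minimizer.
-/

open MeasureTheory Set Filter Topology

noncomputable section

namespace MaxwellSchrodinger

/-! ### Weak derivatives on the line -/

/-- A locally integrable function times a continuous compactly supported one is integrable. -/
lemma integrable_mul_of_hasCompactSupport {u φ : ℝ → ℝ} (hu : LocallyIntegrable u volume)
    (hφ : Continuous φ) (hc : HasCompactSupport φ) : Integrable (fun x => u x * φ x) volume := by
  have := hu.integrable_smul_right_of_hasCompactSupport hφ hc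
  simpa [mul_comm] using this

lemma IsWeakDeriv.ae_unique {u v w : ℝ → ℝ} (hv : IsWeakDeriv u v) (hw : IsWeakDeriv u w) :
    v =ᵐ[volume] w := by
  refine ae_eq_of_integral_contDiff_smul_eq hv.2.1 hw.2.1 fun φ hφ hc => ?_
  have h1 := hv.2.2 φ hφ hc
  have h2 := hw.2.2 φ hφ hc
  simp only [smul_eq_mul, mul_comm (φ _)]
  linarith

lemma isWeakDeriv_weakDeriv {u : ℝ → ℝ} (h : ∃ v, IsWeakDeriv u v) :
    IsWeakDeriv u (weakDeriv u) := by
  rw [weakDeriv, dif_pos h]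
  exact h.choose_spec

lemma IsWeakDeriv.weakDeriv_ae_eq {u v : ℝ → ℝ} (h : IsWeakDeriv u v) :
    weakDeriv u =ᵐ[volume] v :=
  (isWeakDeriv_weakDeriv ⟨v, h⟩).ae_unique h

lemma IsWeakDeriv.sub {u₁ v₁ u₂ v₂ : ℝ → ℝ} (h₁ : IsWeakDeriv u₁ v₁) (h₂ : IsWeakDeriv u₂ v₂) :
    IsWeakDeriv (fun x => u₁ x - u₂ x) (fun x => v₁ x - v₂ x) := by
  refine ⟨h₁.1.sub h₂.1, h₁.2.1.sub h₂.2.1, fun φ hφ hc => ?_⟩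
  have hφ' : Continuous (deriv φ) := hφ.continuous_deriv (by simp)
  simp only [sub_mul]
  rw [integral_sub (integrable_mul_of_hasCompactSupport h₁.1 hφ' hc.deriv)
      (integrable_mul_of_hasCompactSupport h₂.1 hφ' hc.deriv),
    integral_sub (integrable_mul_of_hasCompactSupport h₁.2.1 hφ.continuous hc)
      (integrable_mul_of_hasCompactSupport h₂.2.1 hφ.continuous hc),
    h₁.2.2 φ hφ hc, h₂.2.2 φ hφ hc]
  ring

lemma IsWeakDeriv.congr_left {u u' v : ℝ → ℝ} (h : IsWeakDeriv u v) (hu : u =ᵐ[volume] u') :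
    IsWeakDeriv u' v := by
  refine ⟨h.1.congr hu, h.2.1, fun φ hφ hc => ?_⟩
  rw [← h.2.2 φ hφ hc]
  exact integral_congr_ae (hu.mono fun x hx => by simp [hx])

lemma intervalIntegrable_of_locallyIntegrable {v : ℝ → ℝ} (hv : LocallyIntegrable v volume)
    (a b : ℝ) : IntervalIntegrable v volume a b :=
  (hv.integrableOn_isCompact isCompact_uIcc).intervalIntegrable

/-- The primitive of `v` with value `c` at the origin. -/
def primitive (c : ℝ) (v : ℝ → ℝ) (x : ℝ) : ℝ := c + ∫ t in (0 : ℝ)..x, v t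

lemma continuous_primitive {v : ℝ → ℝ} (hv : LocallyIntegrable v volume) (c : ℝ) :
    Continuous (primitive c v) :=
  continuous_const.add (intervalIntegral.continuous_primitive
    (fun _ _ => intervalIntegrable_of_locallyIntegrable hv _ _) 0)

lemma exists_support_subset_Ioo {φ : ℝ → ℝ} (hc : HasCompactSupport φ) :
    ∃ R : ℝ, 0 < R ∧ tsupport φ ⊆ Ioo (-R) R := by
  obtain ⟨R, hR, h⟩ := hc.isCompact.isBounded.subset_ball_lt 0 0
  exact ⟨R, hR, by simpa [Real.ball_eq_Ioo] using h⟩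

/-- Integration by parts for the absolutely continuous functions `primitive c v` and `φ`. -/
lemma isWeakDeriv_primitive {v : ℝ → ℝ} (hv : LocallyIntegrable v volume) (c : ℝ) :
    IsWeakDeriv (primitive c v) v := by
  refine ⟨(continuous_primitive hv c).locallyIntegrable, hv, fun φ hφ hc => ?_⟩
  obtain ⟨R, hR, hsub⟩ := exists_support_subset_Ioo hc
  have hint : IntervalIntegrable v volume (-R) R := intervalIntegrable_of_locallyIntegrable hv _ _
  have hzero : (0 : ℝ) ∈ uIcc (-R) R := by
    rw [uIcc_of_le (by linarith)]; constructor <;> linarith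
  have hac : AbsolutelyContinuousOnInterval (primitive c v) (-R) R := by
    have h1 := hint.absolutelyContinuousOnInterval_intervalIntegral hzero
    have h2 : AbsolutelyContinuousOnInterval (fun _ : ℝ => c) (-R) R :=
      ContDiffOn.absolutelyContinuousOnInterval contDiffOn_const
    exact h2.add h1
  have hacφ : AbsolutelyContinuousOnInterval φ (-R) R :=
    ContDiffOn.absolutelyContinuousOnInterval (hφ.of_le (by simp)).contDiffOn
  have hparts := hac.integral_mul_deriv_eq_deriv_mul hacφ
  have hφR : φ R = 0 := image_eq_zero_of_notMem_tsupport fun h => (hsub h).2.false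
  have hφR' : φ (-R) = 0 := image_eq_zero_of_notMem_tsupport fun h => (hsub h).1.false
  have hderiv : ∫ x in (-R)..R, deriv (primitive c v) x * φ x = ∫ x in (-R)..R, v x * φ x := by
    refine intervalIntegral.integral_congr_ae ?_
    filter_upwards [hint.ae_hasDerivAt_integral] with x hx hxR
    have := (hx (uIoc_subset_uIcc hxR) 0 hzero).const_add c
    rw [show deriv (primitive c v) x = v x from this.deriv]
  have hIoc : tsupport φ ⊆ Ioc (-R) R := hsub.trans Ioo_subset_Ioc_self
  rw [hφR, hφR', hderiv, intervalIntegral.integral_eq_integral_of_support_subset,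
    intervalIntegral.integral_eq_integral_of_support_subset] at hparts
  · simpa using hparts
  · exact (Function.support_mul_subset_right _ _).trans ((subset_tsupport φ).trans hIoc)
  · exact (Function.support_mul_subset_right _ _).trans ((support_deriv_subset).trans hIoc)

/-- A test function with vanishing integral is the derivative of a test function. -/
lemma exists_deriv_eq_of_integral_eq_zero {ψ : ℝ → ℝ} (hψ : ContDiff ℝ (⊤ : ℕ∞) ψ)
    (hc : HasCompactSupport ψ) (h0 : ∫ x, ψ x = 0) :
    ∃ φ : ℝ → ℝ, ContDiff ℝ (⊤ : ℕ∞) φ ∧ HasCompactSupport φ ∧ deriv φ = ψ := by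
  obtain ⟨R, hR, hsub⟩ := exists_support_subset_Ioo hc
  have hvan : ∀ x, x ∉ Ioo (-R) R → ψ x = 0 := fun x hx =>
    image_eq_zero_of_notMem_tsupport fun h => hx (hsub h)
  have hder : ∀ x, HasDerivAt (fun x => ∫ t in (-R)..x, ψ t) (ψ x) x := fun x =>
    intervalIntegral.integral_hasDerivAt_right (hψ.continuous.intervalIntegrable _ _)
      hψ.continuous.aestronglyMeasurable.stronglyMeasurableAtFilter hψ.continuous.continuousAt
  have hderiv : deriv (fun x => ∫ t in (-R)..x, ψ t) = ψ := funext fun x => (hder x).deriv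
  refine ⟨fun x => ∫ t in (-R)..x, ψ t, ?_, ?_, hderiv⟩
  · exact contDiff_infty_iff_deriv.2 ⟨fun x => (hder x).differentiableAt, by rw [hderiv]; exact hψ⟩
  · refine HasCompactSupport.of_support_subset_isCompact (isCompact_Icc (a := -R) (b := R)) ?_
    intro x hx
    by_contra hxR
    apply hx
    change ∫ t in (-R)..x, ψ t = 0
    rcases lt_or_ge x (-R) with h | h
    · rw [intervalIntegral.integral_congr (g := fun _ => (0 : ℝ))]
      · simp
      · intro t ht
        rw [uIcc_of_ge h.le] at ht
        exact hvan t fun h' => by linarith [ht.2, h'.1]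
    · have hx' : R < x := by by_contra h'; exact hxR ⟨h, not_lt.1 h'⟩
      rw [intervalIntegral.integral_eq_integral_of_support_subset, h0]
      intro t ht
      have : t ∈ Ioo (-R) R := by by_contra h'; exact ht (hvan t h')
      exact ⟨this.1, by linarith [this.2]⟩

/-- The lemma of du Bois-Reymond: testing against `ψ` agrees with testing against `(∫ ψ) η` for a
fixed `η` of integral one, because the difference of the two is a derivative. -/
lemma IsWeakDeriv.ae_eq_const {h : ℝ → ℝ} (hh : IsWeakDeriv h (fun _ => 0)) :
    ∃ c : ℝ, h =ᵐ[volume] fun _ => c := by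
  let b : ContDiffBump (0 : ℝ) := ⟨1, 2, one_pos, one_lt_two⟩
  let η : ℝ → ℝ := b.normed volume
  have hη : ContDiff ℝ (⊤ : ℕ∞) η := b.contDiff_normed
  have hηc : HasCompactSupport η := b.hasCompactSupport_normed
  have hη1 : ∫ x, η x = 1 := b.integral_normed
  refine ⟨∫ x, h x * η x, ?_⟩
  refine ae_eq_of_integral_contDiff_smul_eq hh.1 (locallyIntegrable_const _) fun ψ hψ hc => ?_
  have hψi : Integrable ψ volume := hψ.continuous.integrable_of_hasCompactSupport hc
  have hηi : Integrable η volume := hη.continuous.integrable_of_hasCompactSupport hηc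
  obtain ⟨φ, hφ, hφc, hφd⟩ := exists_deriv_eq_of_integral_eq_zero
    (ψ := fun x => ψ x - (∫ y, ψ y) * η x) (hψ.sub (contDiff_const.mul hη))
    (hc.sub (hηc.mul_left)) (by
      rw [integral_sub hψi (hηi.const_mul _), integral_const_mul, hη1]; ring)
  have key := hh.2.2 φ hφ hφc
  rw [hφd] at key
  have e : ∀ x, h x * (ψ x - (∫ y, ψ y) * η x) = h x * ψ x - (∫ y, ψ y) * (h x * η x) :=
    fun x => by ring
  simp only [e] at key
  rw [integral_sub (integrable_mul_of_hasCompactSupport hh.1 hψ.continuous hc)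
    ((integrable_mul_of_hasCompactSupport hh.1 hη.continuous hηc).const_mul _),
    integral_const_mul] at key
  simp only [smul_eq_mul, mul_comm (ψ _), integral_const_mul]
  simp only [zero_mul, integral_zero, neg_zero] at key
  linarith

/-- A weakly differentiable function is almost everywhere a primitive of its weak derivative. -/
lemma IsWeakDeriv.exists_ae_eq_primitive {u v : ℝ → ℝ} (h : IsWeakDeriv u v) :
    ∃ c : ℝ, u =ᵐ[volume] primitive c v := by
  have hsub := h.sub (isWeakDeriv_primitive h.2.1 0)
  simp only [sub_self] at hsub
  obtain ⟨c, hc⟩ := hsub.ae_eq_const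
  refine ⟨c, hc.mono fun x hx => ?_⟩
  simp only [primitive, zero_add] at hx ⊢
  linarith

/-! ### Weak compactness in `L²` and Fatou's lemma -/

/-- A sequence in `L²(ℝ)` with convergent norms has a weakly convergent subsequence, and the norm
does not increase in the limit. -/
lemma exists_subseq_tendsto_integral_mul {v : ℕ → ℝ → ℝ} (hv : ∀ n, MemLp (v n) 2 volume) {A : ℝ}
    (hA : Tendsto (fun n => ∫ x, v n x ^ 2) atTop (𝓝 A)) :
    ∃ w : ℝ → ℝ, MemLp w 2 volume ∧ (∫ x, w x ^ 2) ≤ A ∧ ∃ φ : ℕ → ℕ, StrictMono φ ∧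
      ∀ g : ℝ → ℝ, MemLp g 2 volume →
        Tendsto (fun n => ∫ x, v (φ n) x * g x) atTop (𝓝 (∫ x, w x * g x)) := by
  have : Fact ((2 : ENNReal) ≠ ⊤) := ⟨by simp⟩
  let H := Lp ℝ 2 (volume : Measure ℝ)
  have hinner : ∀ {f g : ℝ → ℝ} (hf : MemLp f 2 volume) (hg : MemLp g 2 volume),
      inner ℝ (hf.toLp f : H) (hg.toLp g) = ∫ x, f x * g x := by
    intro f g hf hg
    rw [L2.inner_def]
    refine integral_congr_ae ?_
    filter_upwards [hf.coeFn_toLp, hg.coeFn_toLp] with x h1 h2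
    simp [h1, h2, mul_comm]
  have hnorm : ∀ {f : ℝ → ℝ} (hf : MemLp f 2 volume), ‖(hf.toLp f : H)‖ ^ 2 = ∫ x, f x ^ 2 := by
    intro f hf
    rw [← real_inner_self_eq_norm_sq, hinner hf hf]
    simp only [sq]
  let V : ℕ → H := fun n => (hv n).toLp (v n)
  obtain ⟨M, hM⟩ := hA.bddAbove_range
  have hVM : ∀ n, ‖V n‖ ≤ Real.sqrt M := fun n => by
    apply Real.le_sqrt_of_sq_le
    rw [hnorm (hv n)]
    exact hM ⟨n, rfl⟩
  let ℓ : ℕ → WeakDual ℝ H := fun n => StrongDual.toWeakDual (InnerProductSpace.toDual ℝ H (V n))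
  obtain ⟨L, -, φ, hφ, hL⟩ := WeakDual.isSeqCompact_closedBall ℝ H 0 (Real.sqrt M)
    (x := ℓ) (fun n => by
      simp only [mem_preimage, Metric.mem_closedBall, dist_zero_right, ℓ]
      exact ((InnerProductSpace.toDual ℝ H).norm_map _).le.trans (hVM n))
  let W : H := (InnerProductSpace.toDual ℝ H).symm (WeakDual.toStrongDual L)
  have hweak : ∀ G : H, Tendsto (fun n => inner ℝ (V (φ n)) G) atTop (𝓝 (inner ℝ W G)) := by
    intro G
    have h1 := ((WeakDual.eval_continuous G).tendsto L).comp hL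
    have h2 : inner ℝ W G = L G := by
      simp [W]
    rw [h2]
    exact h1
  have hW : MemLp (W : ℝ → ℝ) 2 volume := Lp.memLp W
  have hWW : (hW.toLp (W : ℝ → ℝ) : H) = W := Lp.toLp_coeFn W hW
  refine ⟨W, hW, ?_, φ, hφ, fun g hg => ?_⟩
  · -- `2 ⟪v, w⟫ ≤ ‖v‖² + ‖w‖²` passes to the limit
    rw [← hnorm hW, hWW]
    have h1 : Tendsto (fun n => ‖V (φ n)‖ ^ 2 + ‖W‖ ^ 2 - 2 * inner ℝ (V (φ n)) W) atTop
        (𝓝 (A + ‖W‖ ^ 2 - 2 * inner ℝ W W)) := by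
      refine Tendsto.sub (Tendsto.add ?_ tendsto_const_nhds) ((hweak W).const_mul 2)
      refine (hA.comp hφ.tendsto_atTop).congr fun n => ?_
      exact (hnorm (hv (φ n))).symm
    have h2 := ge_of_tendsto' h1 (b := 0) fun n => by
      have := norm_sub_sq_real (V (φ n)) W
      nlinarith [sq_nonneg ‖V (φ n) - W‖]
    rw [real_inner_self_eq_norm_sq] at h2
    linarith
  · have h1 := hweak (hg.toLp g)
    rw [← hWW, hinner hW hg] at h1
    refine h1.congr fun n => ?_
    exact hinner (hv (φ n)) hg

/-- Fatou's lemma for nonnegative integrable functions with convergent integrals. -/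
lemma integrable_and_integral_le_of_tendsto {α : Type*} [MeasurableSpace α] {μ : Measure α}
    {f : ℕ → α → ℝ} {g : α → ℝ} {L : ℝ} (hf : ∀ n, Integrable (f n) μ) (hf0 : ∀ n x, 0 ≤ f n x)
    (hfg : ∀ x, Tendsto (fun n => f n x) atTop (𝓝 (g x)))
    (hL : Tendsto (fun n => ∫ x, f n x ∂μ) atTop (𝓝 L)) :
    Integrable g μ ∧ ∫ x, g x ∂μ ≤ L := by
  have hg0 : ∀ x, 0 ≤ g x := fun x => ge_of_tendsto' (hfg x) fun n => hf0 n x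
  have hgm : AEStronglyMeasurable g μ :=
    aestronglyMeasurable_of_tendsto_ae atTop (fun n => (hf n).aestronglyMeasurable)
      (Eventually.of_forall hfg)
  have hL0 : 0 ≤ L := ge_of_tendsto' hL fun n => integral_nonneg (hf0 n)
  have key : ∫⁻ x, ENNReal.ofReal (g x) ∂μ ≤ ENNReal.ofReal L := by
    have h1 : ∀ x, ENNReal.ofReal (g x) = liminf (fun n => ENNReal.ofReal (f n x)) atTop :=
      fun x => (ENNReal.tendsto_ofReal (hfg x)).liminf_eq.symm
    have h2 : liminf (fun n => ∫⁻ x, ENNReal.ofReal (f n x) ∂μ) atTop = ENNReal.ofReal L := by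
      refine ((ENNReal.tendsto_ofReal hL).congr fun n => ?_).liminf_eq
      exact ofReal_integral_eq_lintegral_ofReal (hf n) (Eventually.of_forall (hf0 n))
    simp only [h1]
    rw [← h2]
    exact lintegral_liminf_le' fun n => (hf n).aestronglyMeasurable.aemeasurable.ennreal_ofReal
  have hgi : Integrable g μ :=
    ⟨hgm, (hasFiniteIntegral_iff_ofReal (Eventually.of_forall hg0)).2
      (key.trans_lt ENNReal.ofReal_lt_top)⟩
  refine ⟨hgi, ?_⟩
  rw [← ofReal_integral_eq_lintegral_ofReal hgi (Eventually.of_forall hg0)] at key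
  exact (ENNReal.ofReal_le_ofReal_iff hL0).1 key

/-! ### Tightness from the neutral Coulomb energy -/

lemma coulombKernel_one_nonneg (x y : ℝ) : 0 ≤ coulombKernel 1 x y := by
  have := abs_sub x y
  unfold coulombKernel
  linarith

lemma continuous_coulombKernel (z : ℝ) : Continuous fun p : ℝ × ℝ => coulombKernel z p.1 p.2 := by
  unfold coulombKernel
  fun_prop

/-- Mass in a set on which the kernel is at least `R` costs energy at least `R` times its square. -/
lemma mul_sq_setIntegral_le_bQuad {f : ℝ → ℝ} {G : ℝ → ℝ → ℝ} (hf0 : ∀ x, 0 ≤ f x)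
    (hf : Integrable f volume) (hG0 : ∀ x y, 0 ≤ G x y)
    (hG : Integrable (fun p : ℝ × ℝ => f p.1 * f p.2 * G p.1 p.2) volume) {R : ℝ} {s : Set ℝ}
    (hs : MeasurableSet s) (hR : ∀ x ∈ s, ∀ y ∈ s, R ≤ G x y) :
    R * (∫ x in s, f x) ^ 2 ≤ bQuad G f := by
  have hprod : Integrable (fun p : ℝ × ℝ => f p.1 * f p.2) volume := hf.mul_prod hf
  calc R * (∫ x in s, f x) ^ 2 = ∫ p in s ×ˢ s, f p.1 * f p.2 * R := by
        rw [integral_mul_const, Measure.volume_eq_prod, setIntegral_prod_mul]; ring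
    _ ≤ ∫ p in s ×ˢ s, f p.1 * f p.2 * G p.1 p.2 := by
        refine setIntegral_mono_on (hprod.mul_const R).integrableOn hG.integrableOn
          (hs.prod hs) fun p hp => ?_
        exact mul_le_mul_of_nonneg_left (hR _ hp.1 _ hp.2) (mul_nonneg (hf0 _) (hf0 _))
    _ ≤ bQuad G f := setIntegral_le_integral hG
        (Eventually.of_forall fun p => mul_nonneg (mul_nonneg (hf0 _) (hf0 _)) (hG0 _ _))

/-- A bound on the neutral Coulomb energy makes the mass outside `[-R, R]` of order `R ^ (-1/2)`. -/
lemma integral_sub_setIntegral_Icc_le {f : ℝ → ℝ} (hf0 : ∀ x, 0 ≤ f x)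
    (hf : Integrable f volume)
    (hG : Integrable (fun p : ℝ × ℝ => f p.1 * f p.2 * coulombKernel 1 p.1 p.2) volume)
    {M R : ℝ} (hM : bQuad (coulombKernel 1) f ≤ M) (hR : 0 < R) :
    (∫ x, f x) - ∫ x in Icc (-R) R, f x ≤ 2 * Real.sqrt (M / R) := by
  have bound : ∀ s : Set ℝ, MeasurableSet s →
      (∀ x ∈ s, ∀ y ∈ s, R ≤ coulombKernel 1 x y) → ∫ x in s, f x ≤ Real.sqrt (M / R) := by
    intro s hs hRs
    apply Real.le_sqrt_of_sq_le
    rw [le_div_iff₀ hR, mul_comm]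
    exact (mul_sq_setIntegral_le_bQuad hf0 hf coulombKernel_one_nonneg hG hs hRs).trans hM
  have hI := bound (Ioi R) measurableSet_Ioi fun x hx y hy => by
    have hx : R < x := hx
    have hy : R < y := hy
    unfold coulombKernel
    rw [abs_of_pos (hR.trans hx), abs_of_pos (hR.trans hy)]
    rcases abs_cases (x - y) with h | h <;> linarith [h.1]
  have hII := bound (Iio (-R)) measurableSet_Iio fun x hx y hy => by
    have hx : x < -R := hx
    have hy : y < -R := hy
    unfold coulombKernel
    rw [abs_of_neg (by linarith : x < 0), abs_of_neg (by linarith : y < 0)]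
    rcases abs_cases (x - y) with h | h <;> linarith [h.1]
  have hsplit := integral_add_compl (measurableSet_Icc (a := -R) (b := R)) hf
  have hcompl : (Icc (-R) R)ᶜ = Iio (-R) ∪ Ioi R := by
    ext x
    simp only [mem_compl_iff, mem_Icc, mem_union, mem_Iio, mem_Ioi, not_and_or, not_le]
  have hdisj : Disjoint (Iio (-R)) (Ioi R) := by
    refine Set.disjoint_left.2 fun x h1 h2 => ?_
    simp only [mem_Iio, mem_Ioi] at h1 h2
    linarith
  rw [hcompl, setIntegral_union hdisj measurableSet_Ioi hf.integrableOn hf.integrableOn] at hsplit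
  linarith

/-! ### The unit sphere of the neutral space in terms of primitives -/

lemma eLpNorm_two_eq_one_iff {u : ℝ → ℝ} (hu : MemLp u 2 volume) :
    eLpNorm u 2 volume = 1 ↔ ∫ x, u x ^ 2 = 1 := by
  rw [hu.eLpNorm_eq_integral_rpow_norm (by simp) (by simp)]
  simp only [ENNReal.toReal_ofNat, Real.rpow_two, Real.norm_eq_abs, sq_abs]
  rw [ENNReal.ofReal_eq_one, ← one_div, ← Real.sqrt_eq_rpow, Real.sqrt_eq_one]

/-- The primitive of `v ∈ L²` with value `c` at the origin has unit mass and finite neutral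
Coulomb energy. -/
structure IsAdmissible (c : ℝ) (v : ℝ → ℝ) : Prop where
  memLp : MemLp v 2 volume
  integrable_sq : Integrable (fun x => primitive c v x ^ 2) volume
  integral_sq : ∫ x, primitive c v x ^ 2 = 1
  integrable_kernel : Integrable (fun p : ℝ × ℝ =>
    primitive c v p.1 ^ 2 * primitive c v p.2 ^ 2 * coulombKernel 1 p.1 p.2) volume

lemma locallyIntegrable_of_memLp_two {v : ℝ → ℝ} (hv : MemLp v 2 volume) :
    LocallyIntegrable v volume :=
  hv.locallyIntegrable one_le_two

lemma energy_eq_of_isWeakDeriv {u v : ℝ → ℝ} (h : IsWeakDeriv u v) (z : ℝ) :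
    energy z u = (∫ x, v x ^ 2) + bQuad (coulombKernel z) (fun x => u x ^ 2) := by
  unfold energy
  rw [integral_congr_ae (g := fun x => v x ^ 2)
    (h.weakDeriv_ae_eq.mono fun x hx => by simp only [hx])]

lemma IsAdmissible.mem_unitSphere {c : ℝ} {v : ℝ → ℝ} (h : IsAdmissible c v) :
    primitive c v ∈ unitSphere neutralSpace := by
  have hloc := locallyIntegrable_of_memLp_two h.memLp
  have hL : MemLp (primitive c v) 2 volume :=
    (memLp_two_iff_integrable_sq (continuous_primitive hloc c).aestronglyMeasurable).2
      h.integrable_sq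
  exact ⟨⟨⟨hL, v, h.memLp, isWeakDeriv_primitive hloc c⟩, h.integrable_kernel⟩,
    (eLpNorm_two_eq_one_iff hL).2 h.integral_sq⟩

lemma IsAdmissible.energy_eq {c : ℝ} {v : ℝ → ℝ} (h : IsAdmissible c v) :
    energy 1 (primitive c v) =
      (∫ x, v x ^ 2) + bQuad (coulombKernel 1) (fun x => primitive c v x ^ 2) :=
  energy_eq_of_isWeakDeriv (isWeakDeriv_primitive (locallyIntegrable_of_memLp_two h.memLp) c) 1

/-- Up to null sets the unit sphere consists of admissible primitives. -/
lemma exists_isAdmissible_energy_eq {u : ℝ → ℝ} (hu : u ∈ unitSphere neutralSpace) :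
    ∃ c v, IsAdmissible c v ∧ energy 1 (primitive c v) = energy 1 u := by
  obtain ⟨⟨⟨hu2, v, hv, huv⟩, hK⟩, hnorm⟩ := hu
  obtain ⟨c, hc⟩ := huv.exists_ae_eq_primitive
  have hsq : (fun x => u x ^ 2) =ᵐ[volume] fun x => primitive c v x ^ 2 :=
    hc.mono fun x hx => by simp only [hx]
  have hker : (fun p : ℝ × ℝ => u p.1 ^ 2 * u p.2 ^ 2 * coulombKernel 1 p.1 p.2) =ᵐ[volume]
      fun p => primitive c v p.1 ^ 2 * primitive c v p.2 ^ 2 * coulombKernel 1 p.1 p.2 := by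
    filter_upwards [Measure.quasiMeasurePreserving_fst.ae hsq,
      Measure.quasiMeasurePreserving_snd.ae hsq] with p h1 h2
    rw [h1, h2]
  refine ⟨c, v, ⟨hv, hu2.integrable_sq.congr hsq, ?_, hK.congr hker⟩, ?_⟩
  · rw [← integral_congr_ae hsq]
    exact (eLpNorm_two_eq_one_iff hu2).1 hnorm
  · rw [energy_eq_of_isWeakDeriv huv, energy_eq_of_isWeakDeriv (huv.congr_left hc)]
    unfold bQuad bForm
    rw [integral_congr_ae hker]

lemma bQuad_coulombKernel_one_nonneg (u : ℝ → ℝ) :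
    0 ≤ bQuad (coulombKernel 1) (fun x => u x ^ 2) :=
  integral_nonneg fun _ => mul_nonneg (mul_nonneg (sq_nonneg _) (sq_nonneg _))
    (coulombKernel_one_nonneg _ _)

lemma energy_one_nonneg (u : ℝ → ℝ) : 0 ≤ energy 1 u :=
  add_nonneg (integral_nonneg fun _ => sq_nonneg _) (bQuad_coulombKernel_one_nonneg u)

/-- A normalised smooth bump function is admissible, so the constraint set is nonempty. -/
lemma exists_isAdmissible : ∃ c v, IsAdmissible c v := by
  let b : ContDiffBump (0 : ℝ) := ⟨1, 2, one_pos, one_lt_two⟩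
  have hbc : HasCompactSupport (b : ℝ → ℝ) := b.hasCompactSupport
  have hbc2 : HasCompactSupport fun x => b x ^ 2 := by
    simp only [sq]
    exact hbc.mul_left
  have hb2 : Integrable (fun x => b x ^ 2) volume :=
    (b.continuous.pow 2).integrable_of_hasCompactSupport hbc2
  have hpos : 0 < ∫ x, b x ^ 2 := by
    refine (b.continuous.pow 2).integral_pos_of_hasCompactSupport_nonneg_nonzero (x := 0)
      hbc2 (fun x => sq_nonneg _) ?_
    have : b 0 = 1 := b.one_of_mem_closedBall (by simp [b])
    simp [this]
  set N := Real.sqrt (∫ x, b x ^ 2) with hN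
  have hN2 : N ^ 2 = ∫ x, b x ^ 2 := Real.sq_sqrt hpos.le
  let w : ℝ → ℝ := fun x => N⁻¹ * b x
  have hw : ContDiff ℝ (⊤ : ℕ∞) w := contDiff_const.mul b.contDiff
  have hwc : HasCompactSupport w := hbc.mul_left
  have hw' : Continuous (deriv w) := hw.continuous_deriv (by simp)
  have hprim : primitive (w 0) (deriv w) = w := by
    funext x
    unfold primitive
    rw [intervalIntegral.integral_deriv_eq_sub
      (fun x _ => (hw.differentiable (by simp)) x) (hw'.intervalIntegrable _ _)]
    ring
  have hw2 : (fun x => w x ^ 2) = fun x => (N ^ 2)⁻¹ * b x ^ 2 := by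
    funext x; simp only [w]; ring
  refine ⟨w 0, deriv w, hw'.memLp_of_hasCompactSupport hwc.deriv, ?_, ?_, ?_⟩
  · rw [hprim, hw2]; exact hb2.const_mul _
  · rw [hprim, hw2, integral_const_mul, hN2, inv_mul_cancel₀ hpos.ne']
  · rw [hprim]
    refine Continuous.integrable_of_hasCompactSupport ?_ ?_
    · exact ((((hw.continuous.comp continuous_fst).pow 2).mul
        ((hw.continuous.comp continuous_snd).pow 2))).mul (continuous_coulombKernel 1)
    · refine HasCompactSupport.of_support_subset_isCompact
        (hwc.isCompact.prod hwc.isCompact) fun p hp => ?_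
      simp only [Function.mem_support, ne_eq, mul_eq_zero, pow_eq_zero_iff, not_or,
        OfNat.ofNat_ne_zero, not_false_eq_true] at hp
      exact ⟨subset_tsupport _ hp.1.1, subset_tsupport _ hp.1.2⟩

/-! ### Compactness of energy-bounded sequences -/

/-- The bound uses `|v| ≤ (1 + v²) / 2` in place of the Cauchy-Schwarz inequality. -/
lemma abs_intervalIntegral_le {v : ℝ → ℝ} (hv : MemLp v 2 volume) (x : ℝ) :
    |∫ t in (0 : ℝ)..x, v t| ≤ (|x| + ∫ t, v t ^ 2) / 2 := by
  have hsq := hv.integrable_sq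
  have hfin : volume (uIoc (0 : ℝ) x) ≠ ⊤ := by simp [uIoc]
  have hone : IntegrableOn (fun _ : ℝ => (1 : ℝ)) (uIoc 0 x) volume := integrableOn_const hfin
  calc |∫ t in (0 : ℝ)..x, v t| ≤ ∫ t in uIoc 0 x, |v t| := by
        simpa only [Real.norm_eq_abs] using
          intervalIntegral.norm_integral_le_integral_norm_uIoc (f := v) (μ := volume)
    _ ≤ ∫ t in uIoc 0 x, (1 + v t ^ 2) / 2 := by
        refine setIntegral_mono ?_ ((hone.add hsq.integrableOn).div_const 2) fun t => ?_
        · exact ((locallyIntegrable_of_memLp_two hv).integrableOn_isCompact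
            isCompact_uIcc).mono_set uIoc_subset_uIcc |>.abs
        · nlinarith [sq_nonneg (|v t| - 1), sq_abs (v t)]
    _ = (|x| + ∫ t in uIoc 0 x, v t ^ 2) / 2 := by
        rw [integral_div, integral_add hone hsq.integrableOn]
        simp [measureReal_def, uIoc, max_sub_min_eq_abs]
    _ ≤ (|x| + ∫ t, v t ^ 2) / 2 := by
        have := setIntegral_le_integral (s := uIoc 0 x) hsq
          (Eventually.of_forall fun t => sq_nonneg (v t))
        linarith

/-- The value at the origin is controlled by the masses of the function and of its derivative. -/
lemma IsAdmissible.sq_le {c : ℝ} {v : ℝ → ℝ} (h : IsAdmissible c v) :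
    c ^ 2 ≤ 2 + 2 * ((1 + ∫ t, v t ^ 2) / 2) ^ 2 := by
  -- Integrate `c² ≤ 2 u² + 2 (u - c)²` over `[0, 1]`, where `u` is the primitive.
  set B := (1 + ∫ t, v t ^ 2) / 2 with hB
  have hpt : ∀ x ∈ Icc (0 : ℝ) 1, c ^ 2 ≤ 2 * primitive c v x ^ 2 + 2 * B ^ 2 := by
    intro x hx
    have h1 := abs_intervalIntegral_le h.memLp x
    rw [abs_of_nonneg hx.1] at h1
    have h2 : (∫ t in (0 : ℝ)..x, v t) ^ 2 ≤ B ^ 2 := by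
      refine sq_le_sq.2 (h1.trans (le_trans ?_ (le_abs_self B)))
      rw [hB]; linarith [hx.2]
    unfold primitive
    nlinarith [sq_nonneg (c + 2 * ∫ t in (0 : ℝ)..x, v t)]
  have hone : ∀ a : ℝ, IntegrableOn (fun _ : ℝ => a) (Icc 0 1) volume := fun a =>
    integrableOn_const (by simp)
  have hmono := setIntegral_mono_on (hone (c ^ 2))
    ((h.integrable_sq.integrableOn.const_mul 2).add (hone (2 * B ^ 2))) measurableSet_Icc hpt
  have hle := setIntegral_le_integral (s := Icc (0 : ℝ) 1) h.integrable_sq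
    (Eventually.of_forall fun t => sq_nonneg _)
  simp only [Pi.add_apply] at hmono
  rw [integral_add (h.integrable_sq.integrableOn.const_mul 2) (hone _), integral_const_mul] at hmono
  simp only [integral_const, measureReal_restrict_apply_univ, Real.volume_real_Icc, sub_zero,
    zero_le_one, sup_of_le_left, smul_eq_mul, one_mul] at hmono
  rw [h.integral_sq] at hle
  linarith

/-- Weak convergence tested against indicators of intervals gives pointwise convergence of
primitives. -/
lemma tendsto_primitive {c : ℕ → ℝ} {v : ℕ → ℝ → ℝ} {c₀ : ℝ} {w : ℝ → ℝ}
    (hc : Tendsto c atTop (𝓝 c₀))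
    (hv : ∀ g : ℝ → ℝ, MemLp g 2 volume →
      Tendsto (fun n => ∫ x, v n x * g x) atTop (𝓝 (∫ x, w x * g x))) (x : ℝ) :
    Tendsto (fun n => primitive (c n) (v n) x) atTop (𝓝 (primitive c₀ w x)) := by
  have hmeas : MeasurableSet (uIoc (0 : ℝ) x) := measurableSet_uIoc
  have hg : MemLp ((uIoc (0 : ℝ) x).indicator fun _ => (1 : ℝ)) 2 volume :=
    memLp_indicator_const 2 hmeas 1 (Or.inr (by simp [uIoc]))
  have hmul : ∀ f : ℝ → ℝ, ∫ t, f t * (uIoc (0 : ℝ) x).indicator (fun _ => (1 : ℝ)) t =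
      ∫ t in uIoc 0 x, f t := by
    intro f
    rw [← integral_indicator hmeas]
    refine integral_congr_ae (Eventually.of_forall fun t => ?_)
    by_cases ht : t ∈ uIoc (0 : ℝ) x <;> simp [ht]
  have h1 := hv _ hg
  simp only [hmul] at h1
  unfold primitive
  simp only [intervalIntegral.intervalIntegral_eq_integral_uIoc]
  exact hc.add (h1.const_smul _)

/-- Along admissible functions with weakly convergent derivatives the Coulomb energy is lower
semicontinuous, and by tightness the mass constraint survives in the limit. -/
lemma isAdmissible_of_tendsto {c : ℕ → ℝ} {v : ℕ → ℝ → ℝ} {c₀ : ℝ} {w : ℝ → ℝ} {A C : ℝ}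
    (hadm : ∀ n, IsAdmissible (c n) (v n)) (hc : Tendsto c atTop (𝓝 c₀)) (hw : MemLp w 2 volume)
    (hv : ∀ g : ℝ → ℝ, MemLp g 2 volume →
      Tendsto (fun n => ∫ x, v n x * g x) atTop (𝓝 (∫ x, w x * g x)))
    (hA : Tendsto (fun n => ∫ x, v n x ^ 2) atTop (𝓝 A))
    (hC : Tendsto (fun n => bQuad (coulombKernel 1) fun x => primitive (c n) (v n) x ^ 2)
      atTop (𝓝 C)) :
    IsAdmissible c₀ w ∧ bQuad (coulombKernel 1) (fun x => primitive c₀ w x ^ 2) ≤ C := by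
  have hpt := tendsto_primitive hc hv
  obtain ⟨hsqi, hsq1⟩ := integrable_and_integral_le_of_tendsto (fun n => (hadm n).integrable_sq)
    (fun n x => sq_nonneg _) (fun x => (hpt x).pow 2)
    (tendsto_const_nhds.congr fun n => (hadm n).integral_sq.symm)
  obtain ⟨hKi, hKC⟩ := integrable_and_integral_le_of_tendsto
    (fun n => (hadm n).integrable_kernel)
    (fun n p => mul_nonneg (mul_nonneg (sq_nonneg _) (sq_nonneg _))
      (coulombKernel_one_nonneg p.1 p.2))
    (fun p => (((hpt p.1).pow 2).mul ((hpt p.2).pow 2)).mul_const (coulombKernel 1 p.1 p.2)) hC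
  refine ⟨⟨hw, hsqi, le_antisymm hsq1 ?_, hKi⟩, hKC⟩
  obtain ⟨M, hM⟩ := hC.bddAbove_range
  obtain ⟨A', hA'⟩ := hA.bddAbove_range
  obtain ⟨D, hD⟩ := (hc.abs).bddAbove_range
  have hloc : ∀ n, Continuous (primitive (c n) (v n)) := fun n =>
    continuous_primitive (locallyIntegrable_of_memLp_two (hadm n).memLp) _
  -- No mass escapes a large interval, and on the interval convergence is dominated.
  have hlow : ∀ R : ℝ, 0 < R → 1 - 2 * Real.sqrt (M / R) ≤ ∫ x, primitive c₀ w x ^ 2 := by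
    intro R hR
    have hlim : Tendsto (fun n => ∫ x in Icc (-R) R, primitive (c n) (v n) x ^ 2) atTop
        (𝓝 (∫ x in Icc (-R) R, primitive c₀ w x ^ 2)) := by
      refine tendsto_integral_of_dominated_convergence (fun _ => (D + (R + A') / 2) ^ 2)
        (fun n => ((hloc n).pow 2).aestronglyMeasurable)
        (integrableOn_const (by simp)) (fun n => ?_)
        (Eventually.of_forall fun x => (hpt x).pow 2)
      filter_upwards [ae_restrict_mem measurableSet_Icc] with x hx
      have h1 := abs_intervalIntegral_le (hadm n).memLp x
      have h2 : |x| ≤ R := abs_le.2 hx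
      have h3 : ∫ t, v n t ^ 2 ≤ A' := hA' ⟨n, rfl⟩
      have h4 : |c n| ≤ D := hD ⟨n, rfl⟩
      have h5 : |primitive (c n) (v n) x| ≤ D + (R + A') / 2 :=
        (abs_add_le _ _).trans (by linarith)
      rw [Real.norm_eq_abs, abs_of_nonneg (sq_nonneg _), ← sq_abs]
      exact pow_le_pow_left₀ (abs_nonneg _) h5 2
    have h1 : 1 - 2 * Real.sqrt (M / R) ≤ ∫ x in Icc (-R) R, primitive c₀ w x ^ 2 := by
      refine ge_of_tendsto' hlim fun n => ?_
      have := integral_sub_setIntegral_Icc_le (fun x => sq_nonneg _) (hadm n).integrable_sq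
        (hadm n).integrable_kernel (M := M) (hM ⟨n, rfl⟩) hR
      rw [(hadm n).integral_sq] at this
      linarith
    exact h1.trans (setIntegral_le_integral hsqi (Eventually.of_forall fun x => sq_nonneg _))
  have hlimR : Tendsto (fun R : ℝ => 1 - 2 * Real.sqrt (M / R)) atTop (𝓝 1) := by
    have h1 : Tendsto (fun R : ℝ => M / R) atTop (𝓝 0) := tendsto_const_nhds.div_atTop tendsto_id
    have h2 := ((Real.continuous_sqrt.tendsto 0).comp h1).const_mul 2
    simpa using h2.const_sub 1
  exact le_of_tendsto hlimR ((eventually_gt_atTop 0).mono hlow)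

/-- A minimizing sequence for the neutral energy subconverges to a minimizer. -/
lemma exists_energy_eq_sInf :
    ∃ u ∈ unitSphere neutralSpace, energy 1 u = sInf (energy 1 '' unitSphere neutralSpace) := by
  set S := energy 1 '' unitSphere neutralSpace with hS
  have hbdd : BddBelow S := ⟨0, by rintro _ ⟨u, -, rfl⟩; exact energy_one_nonneg u⟩
  have hne : S.Nonempty := by
    obtain ⟨c, v, h⟩ := exists_isAdmissible
    exact ⟨_, _, h.mem_unitSphere, rfl⟩
  obtain ⟨e, -, he, heS⟩ := exists_seq_tendsto_sInf hne hbdd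
  have hex : ∀ n, ∃ c v, IsAdmissible c v ∧ energy 1 (primitive c v) = e n := by
    intro n
    obtain ⟨u, hu, hue⟩ := heS n
    rw [← hue]
    exact exists_isAdmissible_energy_eq hu
  choose c v hadm hen using hex
  obtain ⟨M, hM⟩ := he.bddAbove_range
  have hA : ∀ n, ∫ x, v n x ^ 2 ∈ Icc 0 M := fun n => by
    refine ⟨integral_nonneg fun _ => sq_nonneg _, le_trans ?_ (hM ⟨n, rfl⟩)⟩
    rw [← hen n, (hadm n).energy_eq]
    exact le_add_of_nonneg_right (bQuad_coulombKernel_one_nonneg _)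
  have hcb : ∀ n, c n ∈ Icc (-(2 + 2 * ((1 + M) / 2) ^ 2 + 1)) (2 + 2 * ((1 + M) / 2) ^ 2 + 1) := by
    intro n
    have h1 := (hadm n).sq_le
    have h2 : ((1 + ∫ t, v n t ^ 2) / 2) ^ 2 ≤ ((1 + M) / 2) ^ 2 :=
      pow_le_pow_left₀ (by linarith [(hA n).1]) (by linarith [(hA n).2]) 2
    -- `|c n| ≤ c n ^ 2 + 1`
    constructor <;> nlinarith [sq_nonneg (c n - 1), sq_nonneg (c n + 1)]
  obtain ⟨A, -, φ₁, hφ₁, hA₁⟩ := isCompact_Icc.tendsto_subseq hA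
  obtain ⟨c₀, -, φ₂, hφ₂, hc₂⟩ := isCompact_Icc.tendsto_subseq fun n => hcb (φ₁ n)
  obtain ⟨w, hw, hwA, φ₃, hφ₃, hweak⟩ := exists_subseq_tendsto_integral_mul
    (fun n => (hadm (φ₁ (φ₂ n))).memLp) (hA₁.comp hφ₂.tendsto_atTop)
  -- Both parts of the energy converge along `φ`: the kinetic one to `A`, so the Coulomb one to
  -- `sInf S - A`.
  let φ : ℕ → ℕ := fun n => φ₁ (φ₂ (φ₃ n))
  have hφA : Tendsto (fun n => ∫ x, v (φ n) x ^ 2) atTop (𝓝 A) :=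
    hA₁.comp (hφ₂.comp hφ₃).tendsto_atTop
  have hφC : Tendsto (fun n => bQuad (coulombKernel 1)
      fun x => primitive (c (φ n)) (v (φ n)) x ^ 2) atTop (𝓝 (sInf S - A)) := by
    refine ((he.comp (hφ₁.comp (hφ₂.comp hφ₃)).tendsto_atTop).sub hφA).congr fun n => ?_
    change e (φ n) - _ = _
    rw [← hen, (hadm _).energy_eq]
    ring
  obtain ⟨hadm₀, hC₀⟩ := isAdmissible_of_tendsto (fun n => hadm (φ n))
    (hc₂.comp hφ₃.tendsto_atTop) hw hweak hφA hφC
  refine ⟨_, hadm₀.mem_unitSphere, le_antisymm ?_ (csInf_le hbdd ⟨_, hadm₀.mem_unitSphere, rfl⟩)⟩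
  rw [hadm₀.energy_eq]
  linarith

end MaxwellSchrodinger

end

theorem mainTheorem1 :
    BddBelow (MaxwellSchrodinger.energy 1 ''
      MaxwellSchrodinger.unitSphere MaxwellSchrodinger.neutralSpace) ∧
    ∃ u ∈ MaxwellSchrodinger.unitSphere MaxwellSchrodinger.neutralSpace,
      MaxwellSchrodinger.energy 1 u =
        sInf (MaxwellSchrodinger.energy 1 ''
          MaxwellSchrodinger.unitSphere MaxwellSchrodinger.neutralSpace) := by
  refine ⟨⟨0, ?_⟩, MaxwellSchrodinger.exists_energy_eq_sInf⟩
  rintro _ ⟨u, -, rfl⟩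
  exact MaxwellSchrodinger.energy_one_nonneg u
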